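/- Let $T_n$ be an Eulerian tournament on $n \ge 1$ vertices, i.e. an orientation of the complete graph $K_n$ in which every vertex has equal in-degree and out-degree. For a vertex $v$, let $\mathrm{arb}(T_n,v)$ be the number of arborescences of $T_n$ rooted at $v$, i.e. of spanning trees of $T_n$ in which $v$ has out-degree $0$ and every other vertex has out-degree $1$. This number does not depend on $v$; denote it by $\mathrm{arb}(T_n)$. Then $$\mathrm{arb}(T_n) \le \frac{1}{n}\left(\frac{n(n+1)}{4}\right)^{\frac{n-1}{2}},$$ with equality if and only if $T_n$ is a Hadamard (doubly regular) tournament, i.e. its adjacency matrix $A$ satisfies $AA^{T} = \frac{n+1}{4}I + \frac{n-3}{4}J$, where $I$ is the $n\times n$ identity matrix and $J$ is the $n \times n$ all-ones matrix. -/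

import Mathlib

namespace Digraph

/-- Out-degree `d⁺(v)`: the number of arcs leaving `v`. -/
noncomputable def outDegree {V : Type*} (D : Digraph V) (v : V) : ℕ :=
  {w : V | D.Adj v w}.ncard

/-- In-degree `d⁻(v)`: the number of arcs entering `v`. -/
noncomputable def inDegree {V : Type*} (D : Digraph V) (v : V) : ℕ :=
  {w : V | D.Adj w v}.ncard

/-- A tournament: an orientation of the complete graph, i.e. there are no loops, and between any
two distinct vertices there is an arc in exactly one of the two directions. -/
def IsTournament {V : Type*} (D : Digraph V) : Prop :=
  (∀ v : V, ¬ D.Adj v v) ∧ ∀ u v : V, u ≠ v → (D.Adj u v ↔ ¬ D.Adj v u)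

/-- An Eulerian tournament: a tournament in which every vertex has equal in- and out-degree.
(The underlying graph of a tournament is complete, so connectedness is automatic.) -/
def IsEulerianTournament {V : Type*} (D : Digraph V) : Prop :=
  D.IsTournament ∧ ∀ v : V, D.inDegree v = D.outDegree v

/-- `F`, a set of arcs on the vertex set `V`, is an arborescence of `D` rooted at `r`: all its arcs
are arcs of `D`, its underlying graph is a (spanning) tree on `V`, the root `r` has out-degree `0`
in `F` and every other vertex has out-degree `1` in `F`.
(The degree conditions give `F` one arc fewer than there are vertices, as many as the tree has
edges, so no arc is lost on forgetting the orientation: `F` has no loops and no two opposite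
arcs.) -/
def IsArborescence {V : Type*} (D : Digraph V) (r : V) (F : Digraph V) : Prop :=
  (∀ u v : V, F.Adj u v → D.Adj u v) ∧
  F.toSimpleGraphInclusive.IsTree ∧
  F.outDegree r = 0 ∧
  ∀ v : V, v ≠ r → F.outDegree v = 1

/-- `arb(D, r)`: the number of arborescences of `D` rooted at `r`. -/
noncomputable def arb {V : Type*} (D : Digraph V) (r : V) : ℕ :=
  {F : Digraph V | D.IsArborescence r F}.ncard

open Classical in
/-- The adjacency matrix: its `(u, v)` entry is the number (`0` or `1`) of arcs from `u` to `v`. -/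
noncomputable def adjacencyMatrix {V : Type*} (D : Digraph V) : Matrix V V ℝ :=
  Matrix.of fun u v => if D.Adj u v then 1 else 0

/-- A Hadamard (doubly regular) tournament on `n` vertices: a tournament whose adjacency matrix `A`
satisfies `A Aᵀ = ((n + 1) / 4) I + ((n - 3) / 4) J`, where `J` is the all-ones matrix. -/
def IsHadamardTournament {V : Type*} [Fintype V] [DecidableEq V] (D : Digraph V) : Prop :=
  D.IsTournament ∧
  D.adjacencyMatrix * D.adjacencyMatrix.transpose =
    (((Fintype.card V : ℝ) + 1) / 4) • (1 : Matrix V V ℝ) +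
      (((Fintype.card V : ℝ) - 3) / 4) • (Matrix.of fun _ _ => (1 : ℝ))

end Digraph

/-!
The number of arborescences rooted at `v` is a cofactor of the Laplacian `L = diag(d⁺) - A`: this is
the directed matrix tree theorem, `Digraph.arb_eq_det_laplacian_updateRow`. To prove it, the
determinant is expanded in its rows, each of which is a sum over the arcs leaving a vertex. The terms
are indexed by the maps `f` that choose an arc at every vertex other than the root, and the term of
`f` is `1` if all iterates of `f` end in the root and `0` otherwise
(`Digraph.det_one_sub_stepMatrix`). The former maps are the parent maps of the arborescences
(`Digraph.arb_eq_ncard_isParentMap`).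

For an Eulerian tournament on `n` vertices, `L = (n - 1) / 2 • I - A` has vanishing row and column
sums, so `det (L + x J) = n² x arb(T, v)` for each `v` and `x`
(`Digraph.IsEulerianTournament.det_laplacian_add_const`); this makes the number independent of `v`.
Let `c = n (n + 1) / 4`, choose `x` with `n x = √c`, and put `M = L + x J`. The trace of `M Mᵀ` is
`n c`, so `(det M)² = det (M Mᵀ) ≤ cⁿ` by the inequality of arithmetic and geometric means, with
equality exactly if `M Mᵀ = c I` (`Matrix.PosSemidef.det_le_pow_card_of_trace_eq`). As `M Mᵀ` is
`A Aᵀ` plus a combination of `I` and `J`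
(`Digraph.IsEulerianTournament.laplacian_add_const_mul_transpose`), the condition `M Mᵀ = c I` is the
Hadamard condition on `A`.
-/

open Matrix

/-! ### Determinants -/

namespace Matrix

/-- The inequality of arithmetic and geometric means for the eigenvalues: among positive
semidefinite matrices of given trace, the scalar matrix alone has the largest determinant. -/
lemma PosSemidef.det_le_pow_card_of_trace_eq {n : Type*} [Fintype n] [DecidableEq n]
    {N : Matrix n n ℝ} (hN : N.PosSemidef) {c : ℝ} (hc : 0 < c)
    (htr : N.trace = Fintype.card n * c) :
    N.det ≤ c ^ Fintype.card n ∧ (N.det = c ^ Fintype.card n ↔ N = c • 1) := by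
  set μ : n → ℝ := hN.isHermitian.eigenvalues with hμ
  have hμ0 : ∀ i, 0 ≤ μ i := hN.eigenvalues_nonneg
  have hdet : N.det = ∏ i, μ i := by simpa using hN.isHermitian.det_eq_prod_eigenvalues
  have hsum : ∑ i, μ i = Fintype.card n * c := by
    rw [← htr]; simpa using hN.isHermitian.trace_eq_sum_eigenvalues.symm
  -- `t ≤ exp (t - 1)` at the normalized eigenvalues; the exponents add up to `0`.
  have hle : ∀ i, μ i / c ≤ Real.exp (μ i / c - 1) := fun i => by
    linarith [Real.add_one_le_exp (μ i / c - 1)]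
  have hexp : ∏ i, Real.exp (μ i / c - 1) = 1 := by
    rw [← Real.exp_sum, Finset.sum_sub_distrib, ← Finset.sum_div, hsum]
    simp [hc.ne']
  have hprod : ∏ i, μ i / c = N.det / c ^ Fintype.card n := by
    rw [hdet, Finset.prod_div_distrib, Finset.prod_const, Finset.card_univ]
  have hpow : 0 < c ^ Fintype.card n := pow_pos hc _
  refine ⟨?_, fun h => ?_, fun h => by simp [h]⟩
  · rw [← div_le_one hpow, ← hprod, ← hexp]
    exact Finset.prod_le_prod (fun i _ => div_nonneg (hμ0 i) hc.le) fun i _ => hle i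
  · have hpos : ∀ i, 0 < μ i := fun i => by
      refine lt_of_le_of_ne (hμ0 i) fun h0 => ?_
      rw [hdet, Finset.prod_eq_zero (Finset.mem_univ i) h0.symm] at h
      exact hpow.ne h
    have heq : ∀ i, μ i = c := by
      by_contra! hne
      obtain ⟨i, hi⟩ := hne
      have hlt : ∏ i, μ i / c < ∏ i, Real.exp (μ i / c - 1) := by
        refine Finset.prod_lt_prod (fun j _ => div_pos (hpos j) hc) (fun j _ => hle j)
          ⟨i, Finset.mem_univ i, ?_⟩
        have hi' : μ i / c - 1 ≠ 0 := fun h0 => hi (by field_simp at h0; linarith)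
        linarith [Real.add_one_lt_exp hi']
      rw [hexp, hprod, h, div_self hpow.ne'] at hlt
      exact lt_irrefl _ hlt
    have hdiag : diagonal (RCLike.ofReal ∘ μ) = (c • 1 : Matrix n n ℝ) := by
      ext i j
      by_cases hij : i = j <;> simp [hij, heq]
    rw [hN.isHermitian.spectral_theorem, ← hμ, hdiag]
    simp

/-- For a matrix `L` with vanishing row and column sums, the minor at `(r, r)` can be read off from
the rank-one perturbation `L + x J`; in particular it does not depend on `r`. -/
lemma det_add_const_of_sum_eq_zero {n : Type*} [Fintype n] [DecidableEq n]
    {L : Matrix n n ℝ} (hrow : ∀ i, ∑ j, L i j = 0) (hcol : ∀ j, ∑ i, L i j = 0)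
    (x : ℝ) (r : n) :
    (L + of fun _ _ => x).det =
      (Fintype.card n : ℝ) ^ 2 * x * (L.updateRow r (Pi.single r 1)).det := by
  -- Replacing row `r` by the sum of all the rows does not change the determinant.
  have h1 : (L + of fun _ _ => x).det =
      Fintype.card n * x * ((L + of fun _ _ => x).updateRow r 1).det := by
    have h := det_updateRow_sum (L + of fun _ _ => x) r (1 : n → ℝ)
    have hs : ∑ k, (1 : n → ℝ) k • (L + of fun _ _ => x : Matrix n n ℝ) k =
        (Fintype.card n * x) • 1 := by
      ext j
      refine (Finset.sum_apply _ _ _).trans ?_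
      simp [Finset.sum_add_distrib, hcol]
    rw [hs, det_updateRow_smul] at h
    simpa using h.symm
  have h2 : ((L + of fun _ _ => x).updateRow r 1).det = (L.updateRow r 1).det := by
    refine det_eq_of_forall_row_eq_smul_add_const (fun i => if i = r then 0 else x) r
      (by simp) fun i j => ?_
    by_cases hi : i = r <;> simp [updateRow_apply, hi]
  -- The rows `1` and `n • e_r` agree on the vector `1`, which the other rows annihilate.
  have h3 : (L.updateRow r 1).det =
      Fintype.card n * (L.updateRow r (Pi.single r 1)).det := by
    have h0 : (L.updateRow r (1 - (Fintype.card n : ℝ) • Pi.single r 1)).det = 0 := by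
      refine exists_mulVec_eq_zero_iff.mp ⟨1, fun h => by simpa using congrFun h r, ?_⟩
      ext i
      by_cases hi : i = r
      · subst hi
        simp [mulVec, dotProduct, Finset.sum_sub_distrib, ← Finset.mul_sum]
      · simp [mulVec, dotProduct, hi, hrow]
    have h4 := det_updateRow_add L r (1 - (Fintype.card n : ℝ) • Pi.single r 1)
      ((Fintype.card n : ℝ) • Pi.single r 1)
    rw [sub_add_cancel, h0, det_updateRow_smul, zero_add] at h4
    exact h4
  rw [h1, h2, h3]
  ring

lemma det_one_sub_of_isNilpotent {n : Type*} [Fintype n] [DecidableEq n]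
    {P : Matrix n n ℝ} (hP : IsNilpotent P) : (1 - P).det = 1 := by
  have h := sub_eq_zero.mp (isNilpotent_charpoly_sub_pow_of_isNilpotent hP).eq_zero
  have h' := eval_charpoly P 1
  rw [h] at h'
  simpa using h'.symm

end Matrix

/-! ### The row expansion of the Laplacian determinant -/

namespace Digraph

/-- The `0`-`1` transition matrix of the map `f`, killed at `r`: row `v` is the standard basis
vector of `f v` if `v ≠ r`, and row `r` is zero. -/
noncomputable def stepMatrix {V : Type*} [DecidableEq V] (r : V) (f : V → V) : Matrix V V ℝ :=
  of fun v w => if v ≠ r ∧ f v = w then 1 else 0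

lemma stepMatrix_mulVec {V : Type*} [Fintype V] [DecidableEq V] (r : V) (f : V → V)
    (g : V → ℝ) (v : V) :
    (stepMatrix r f *ᵥ g) v = if v = r then 0 else g (f v) := by
  by_cases hv : v = r <;> simp [stepMatrix, mulVec, dotProduct, hv]

lemma stepMatrix_pow_mulVec_eq_zero {V : Type*} [Fintype V] [DecidableEq V] {r : V} {f : V → V}
    (g : V → ℝ) (v : V) {j k : ℕ}
    (hjk : j < k) (h : f^[j] v = r) : ((stepMatrix r f ^ k) *ᵥ g) v = 0 := by
  induction k generalizing j v with
  | zero => omega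
  | succ k ih =>
    rw [pow_succ', ← mulVec_mulVec, stepMatrix_mulVec]
    split_ifs with hv
    · rfl
    · cases j with
      | zero => exact absurd h hv
      | succ j => exact ih (f v) (by omega) h

/-- The determinant that detects whether the iterates of `f` lead every vertex to `r`: if they do,
the transition matrix is nilpotent; if not, the indicator of the vertices that never reach `r` is
a fixed vector of it. -/
lemma det_one_sub_stepMatrix {V : Type*} [Fintype V] [DecidableEq V] {r : V} {f : V → V}
    [Decidable (∀ v, ∃ k, f^[k] v = r)] :
    (1 - stepMatrix r f).det = if ∀ v, ∃ k, f^[k] v = r then 1 else 0 := by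
  split_ifs with h
  · choose k hk using h
    refine det_one_sub_of_isNilpotent ⟨Finset.univ.sup k + 1, ?_⟩
    refine ext_of_mulVec_single fun i => ?_
    ext v
    rw [stepMatrix_pow_mulVec_eq_zero _ v
      (Nat.lt_succ_of_le (Finset.le_sup (Finset.mem_univ v))) (hk v)]
    simp
  · classical
    push Not at h
    obtain ⟨v₀, hv₀⟩ := h
    refine exists_mulVec_eq_zero_iff.mp
      ⟨fun v => if ∀ k, f^[k] v ≠ r then 1 else 0, fun h0 => ?_, ?_⟩
    · have := congrFun h0 v₀
      simp [hv₀] at this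
    · ext v
      rw [sub_mulVec, one_mulVec, Pi.sub_apply, stepMatrix_mulVec, Pi.zero_apply, sub_eq_zero]
      by_cases hv : v = r
      · rw [if_pos hv, if_neg]
        push Not
        exact ⟨0, hv⟩
      · rw [if_neg hv]
        congr 1
        refine propext ⟨fun H k => H (k + 1), fun H k => ?_⟩
        cases k with
        | zero => exact hv
        | succ k => exact H k

/-- The Laplacian `diag(d⁺) - A`. -/
noncomputable def laplacian {V : Type*} [DecidableEq V] (D : Digraph V) : Matrix V V ℝ :=
  diagonal (fun v => (D.outDegree v : ℝ)) - D.adjacencyMatrix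

lemma sum_adjacencyMatrix {V : Type*} [Fintype V] (D : Digraph V) (v : V) :
    ∑ w, D.adjacencyMatrix v w = D.outDegree v := by
  classical
  simp [adjacencyMatrix, outDegree, Set.ncard_eq_toFinset_card']

lemma sum_adjacencyMatrix' {V : Type*} [Fintype V] (D : Digraph V) (w : V) :
    ∑ v, D.adjacencyMatrix v w = D.inDegree w := by
  classical
  simp [adjacencyMatrix, inDegree, Set.ncard_eq_toFinset_card']

/-- `f` is the parent map of an arborescence of `D` rooted at `r`, the root being its own parent. -/
def IsParentMap {V : Type*} (D : Digraph V) (r : V) (f : V → V) : Prop :=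
  f r = r ∧ (∀ v, v ≠ r → D.Adj v (f v)) ∧ ∀ v, ∃ k, f^[k] v = r

/-- Row `v ≠ r` of the Laplacian is the sum of `e_v - e_w` over the arcs `v → w`. Expanding the
determinant in all rows gives a sum over the maps `f` that choose an arc at each `v ≠ r`, and the
term of `f` detects whether `f` is a parent map. -/
lemma det_laplacian_updateRow {V : Type*} [Fintype V] [DecidableEq V] (D : Digraph V) (r : V) :
    (D.laplacian.updateRow r (Pi.single r 1)).det = {f | D.IsParentMap r f}.ncard := by
  classical
  -- Row `r` is written as a sum over `w` too, with the single nonzero term `w = r`.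
  let c : V → V → ℝ := fun v w => if v = r then (if w = r then 1 else 0) else D.adjacencyMatrix v w
  let R : V → V → V → ℝ := fun v w u =>
    (if v = u then 1 else 0) - if v ≠ r ∧ w = u then 1 else 0
  have hrows : D.laplacian.updateRow r (Pi.single r 1) = fun v => ∑ w, c v w • R v w := by
    ext v u
    by_cases hv : v = r
    · subst hv
      simp [c, R, Finset.sum_apply, ite_apply, Pi.single_apply, eq_comm]
    · simp [c, R, hv, laplacian, diagonal_apply, mul_sub, Finset.sum_sub_distrib,
        ← sum_adjacencyMatrix, Finset.sum_apply]
  have hdet : (D.laplacian.updateRow r (Pi.single r 1)).det =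
      ∑ f : V → V, (∏ v, c v (f v)) * (of fun v => R v (f v)).det := by
    rw [hrows]
    refine (MultilinearMap.map_sum (detRowAlternating (R := ℝ) (n := V)).toMultilinearMap
      fun v w => c v w • R v w).trans (Finset.sum_congr rfl fun f _ => ?_)
    exact MultilinearMap.map_smul_univ (detRowAlternating (R := ℝ) (n := V)).toMultilinearMap
      (fun v => c v (f v)) fun v => R v (f v)
  have hterm : ∀ f : V → V, (∏ v, c v (f v)) * (of fun v => R v (f v)).det =
      if D.IsParentMap r f then 1 else 0 := by
    intro f
    have hprod : (∏ v, c v (f v)) =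
        if f r = r ∧ ∀ v, v ≠ r → D.Adj v (f v) then 1 else 0 := by
      split_ifs with h
      · refine Finset.prod_eq_one fun v _ => ?_
        by_cases hv : v = r
        · simp [c, hv, h.1]
        · simp [c, hv, adjacencyMatrix, h.2 v hv]
      · rw [not_and_or] at h
        rcases h with h | h
        · exact Finset.prod_eq_zero (Finset.mem_univ r) (by simp [c, h])
        · push Not at h
          obtain ⟨v, hv, hadj⟩ := h
          exact Finset.prod_eq_zero (Finset.mem_univ v) (by simp [c, hv, adjacencyMatrix, hadj])
    have hR : (of fun v => R v (f v)) = 1 - stepMatrix r f := by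
      ext v u
      simp [R, stepMatrix, one_apply]
    rw [hprod, hR]
    by_cases h : f r = r ∧ ∀ v, v ≠ r → D.Adj v (f v)
    · rw [if_pos h, one_mul, det_one_sub_stepMatrix]
      simp only [IsParentMap, h.1, true_and, and_iff_right h.2]
    · rw [if_neg h, zero_mul, if_neg]
      exact fun H => h ⟨H.1, H.2.1⟩
  rw [hdet, Finset.sum_congr rfl fun f _ => hterm f]
  simp [Set.ncard_eq_toFinset_card']

/-! ### Arborescences and parent maps -/

/-- The digraph with an arc from each `v ≠ r` to `f v` and no others. -/
def ofParentMap {V : Type*} (r : V) (f : V → V) : Digraph V where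
  Adj v w := v ≠ r ∧ f v = w

lemma outDegree_ofParentMap_root {V : Type*} (r : V) (f : V → V) :
    (ofParentMap r f).outDegree r = 0 := by
  simp [outDegree, ofParentMap]

lemma outDegree_ofParentMap {V : Type*} {r v : V} (f : V → V) (hv : v ≠ r) :
    (ofParentMap r f).outDegree v = 1 := by
  simp [outDegree, ofParentMap, hv]

lemma ofParentMap_injOn {V : Type*} (r : V) :
    Set.InjOn (ofParentMap r) {f : V → V | f r = r} := by
  intro f hf g hg h
  ext v
  by_cases hv : v = r
  · rw [hv, hf.out, hg.out]
  · have h' : (ofParentMap r f).Adj v (f v) := ⟨hv, rfl⟩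
    rw [h] at h'
    exact h'.2.symm

/-- A digraph in which `r` has out-degree `0` and all other vertices have out-degree `1` is given
by a map. -/
lemma exists_eq_ofParentMap {V : Type*} [Finite V] {F : Digraph V} {r : V}
    (hr : F.outDegree r = 0) (hF : ∀ v, v ≠ r → F.outDegree v = 1) :
    ∃ f : V → V, f r = r ∧ F = ofParentMap r f := by
  classical
  have h : ∀ v, ∃ w, v ≠ r → {w | F.Adj v w} = {w} := fun v => by
    by_cases hv : v = r
    · exact ⟨v, fun h => absurd hv h⟩
    · obtain ⟨w, hw⟩ := Set.ncard_eq_one.mp (hF v hv)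
      exact ⟨w, fun _ => hw⟩
  choose f hf using h
  have hr' : {w | F.Adj r w} = ∅ := (Set.ncard_eq_zero (Set.toFinite _)).mp hr
  refine ⟨fun v => if v = r then r else f v, by simp, ?_⟩
  ext v w
  by_cases hv : v = r
  · subst hv
    simpa [ofParentMap] using Set.eq_empty_iff_forall_notMem.mp hr' w
  · have := Set.ext_iff.mp (hf v hv) w
    simpa [ofParentMap, hv, eq_comm (b := w)] using this

lemma exists_iterate_eq_of_connected {V : Type*} {r : V} {f : V → V}
    (hc : (ofParentMap r f).toSimpleGraphInclusive.Connected) (v : V) : ∃ k, f^[k] v = r := by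
  obtain ⟨p⟩ := hc.preconnected v r
  generalize hG : (ofParentMap r f).toSimpleGraphInclusive = G at p
  clear hc
  induction p with
  | nil => exact ⟨0, rfl⟩
  | cons h _ ih =>
    -- The vertices leading to `r` are closed under taking neighbours, along and against the arcs.
    subst hG
    obtain ⟨-, ⟨hu, rfl⟩ | ⟨hw, rfl⟩⟩ := h
    · obtain ⟨k, hk⟩ := ih rfl
      exact ⟨k + 1, hk⟩
    · obtain ⟨k, hk⟩ := ih rfl
      cases k with
      | zero => exact absurd hk hw
      | succ k => exact ⟨k, hk⟩

lemma isTree_ofParentMap {V : Type*} [Finite V] {r : V} {f : V → V}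
    (h : ∀ v, ∃ k, f^[k] v = r) : (ofParentMap r f).toSimpleGraphInclusive.IsTree := by
  have hreach : ∀ k v, f^[k] v = r → (ofParentMap r f).toSimpleGraphInclusive.Reachable v r := by
    intro k
    induction k with
    | zero => rintro v rfl; exact SimpleGraph.Reachable.refl _
    | succ k ih =>
      intro v hv
      have h' := ih (f v) hv
      by_cases hvr : v = r
      · exact hvr ▸ SimpleGraph.Reachable.refl _
      · by_cases hvf : v = f v
        · exact hvf ▸ h'
        · exact SimpleGraph.Reachable.trans
            (SimpleGraph.Adj.reachable ⟨hvf, Or.inl ⟨hvr, rfl⟩⟩) h'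
  have hconn : (ofParentMap r f).toSimpleGraphInclusive.Connected := by
    refine (SimpleGraph.connected_iff_exists_forall_reachable _).mpr ⟨r, fun v => ?_⟩
    obtain ⟨k, hk⟩ := h v
    exact (hreach k v hk).symm
  refine SimpleGraph.isTree_iff_connected_and_card.mpr
    ⟨hconn, le_antisymm ?_ hconn.card_vert_le_card_edgeSet_add_one⟩
  -- Every edge joins some `v ≠ r` to `f v`, so there are at most `|V| - 1` edges.
  have hsub : (ofParentMap r f).toSimpleGraphInclusive.edgeSet ⊆
      (fun v => s(v, f v)) '' {r}ᶜ := by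
    intro e
    induction e with
    | _ a b =>
      rintro ⟨-, ⟨ha, hab⟩ | ⟨hb, hba⟩⟩
      · exact ⟨a, ha, congrArg (s(a, ·)) hab⟩
      · exact ⟨b, hb, (congrArg (s(b, ·)) hba).trans Sym2.eq_swap⟩
  have hcard := (Set.ncard_le_ncard hsub (Set.toFinite _)).trans
    (Set.ncard_image_le (Set.toFinite _))
  rw [Nat.card_coe_set_eq]
  have := Set.ncard_add_ncard_compl ({r} : Set V)
  rw [Set.ncard_singleton] at this
  omega

lemma arb_eq_ncard_isParentMap {V : Type*} [Finite V] (D : Digraph V) (r : V) :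
    D.arb r = {f | D.IsParentMap r f}.ncard := by
  have himage : {F | D.IsArborescence r F} = ofParentMap r '' {f | D.IsParentMap r f} := by
    ext F
    constructor
    · rintro ⟨hsub, htree, hr, hF⟩
      obtain ⟨f, hf, rfl⟩ := exists_eq_ofParentMap hr hF
      exact ⟨f, ⟨hf, fun v hv => hsub v _ ⟨hv, rfl⟩,
        exists_iterate_eq_of_connected htree.connected⟩, rfl⟩
    · rintro ⟨f, ⟨-, hadj, hreach⟩, rfl⟩
      refine ⟨?_, isTree_ofParentMap hreach, outDegree_ofParentMap_root r f,
        fun v => outDegree_ofParentMap f⟩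
      rintro v _ ⟨hv, rfl⟩
      exact hadj v hv
  rw [arb, himage]
  exact Set.InjOn.ncard_image ((ofParentMap_injOn r).mono fun f hf => hf.1)

/-- The directed matrix tree theorem. Replacing the row of the root by a standard basis vector
amounts to deleting the row and the column of the root. -/
theorem arb_eq_det_laplacian_updateRow {V : Type*} [Fintype V] [DecidableEq V] (D : Digraph V)
    (r : V) : (D.arb r : ℝ) = (D.laplacian.updateRow r (Pi.single r 1)).det := by
  rw [det_laplacian_updateRow, arb_eq_ncard_isParentMap]

/-! ### The Laplacian of an Eulerian tournament -/

lemma IsTournament.adjacencyMatrix_add_transpose {V : Type*} [DecidableEq V] {T : Digraph V}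
    (hT : T.IsTournament) :
    T.adjacencyMatrix + T.adjacencyMatrixᵀ = (of fun _ _ => 1) - 1 := by
  ext u v
  by_cases huv : u = v
  · subst huv
    simp [adjacencyMatrix, hT.1]
  · have := hT.2 u v huv
    by_cases h : T.Adj v u <;> simp [adjacencyMatrix, huv, this, h]

lemma IsEulerianTournament.outDegree_eq {V : Type*} [Fintype V] {T : Digraph V}
    (hT : T.IsEulerianTournament) (v : V) :
    (T.outDegree v : ℝ) = ((Fintype.card V : ℝ) - 1) / 2 := by
  classical
  have h : ∑ w, (T.adjacencyMatrix + T.adjacencyMatrixᵀ) v w =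
      T.outDegree v + T.outDegree v := by
    simp only [Matrix.add_apply, transpose_apply, Finset.sum_add_distrib, sum_adjacencyMatrix,
      sum_adjacencyMatrix', hT.2 v]
  rw [hT.1.adjacencyMatrix_add_transpose] at h
  simp [one_apply, Finset.sum_sub_distrib] at h
  linarith

lemma IsEulerianTournament.laplacian_eq {V : Type*} [Fintype V] [DecidableEq V] {T : Digraph V}
    (hT : T.IsEulerianTournament) :
    T.laplacian = (((Fintype.card V : ℝ) - 1) / 2) • 1 - T.adjacencyMatrix := by
  rw [laplacian, smul_one_eq_diagonal]
  simp only [hT.outDegree_eq]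

lemma IsEulerianTournament.det_laplacian_add_const {V : Type*} [Fintype V] [DecidableEq V]
    {T : Digraph V} (hT : T.IsEulerianTournament) (x : ℝ) (r : V) :
    (T.laplacian + of fun _ _ => x).det = (Fintype.card V : ℝ) ^ 2 * x * T.arb r := by
  rw [arb_eq_det_laplacian_updateRow]
  refine det_add_const_of_sum_eq_zero (fun v => ?_) (fun w => ?_) x r
  · simp [laplacian, Finset.sum_sub_distrib, diagonal_apply, sum_adjacencyMatrix]
  · simp [laplacian, Finset.sum_sub_distrib, diagonal_apply, sum_adjacencyMatrix', hT.2 w]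

/-- The Gram matrix of the rows of the perturbed Laplacian. -/
lemma IsEulerianTournament.laplacian_add_const_mul_transpose {V : Type*} [Fintype V]
    [DecidableEq V] {T : Digraph V} (hT : T.IsEulerianTournament) (x : ℝ) :
    (T.laplacian + of fun _ _ => x) * (T.laplacian + of fun _ _ => x)ᵀ =
      T.adjacencyMatrix * T.adjacencyMatrixᵀ
        + (((Fintype.card V : ℝ) ^ 2 - 1) / 4) • (1 : Matrix V V ℝ)
        + (Fintype.card V * x ^ 2 - ((Fintype.card V : ℝ) - 1) / 2) •
          (of fun _ _ => (1 : ℝ) : Matrix V V ℝ) := by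
  set n : ℝ := (Fintype.card V : ℝ) with hn
  set A := T.adjacencyMatrix with hA
  set J : Matrix V V ℝ := of fun _ _ => (1 : ℝ) with hJ
  have hx : (of fun _ _ => x : Matrix V V ℝ) = x • J := by ext; simp [hJ]
  have hAJ : A * J = ((n - 1) / 2) • J := by
    ext v w
    simp [mul_apply, hJ, hA, sum_adjacencyMatrix, hT.outDegree_eq, hn]
  have hJT : Jᵀ = J := rfl
  have hJA : J * Aᵀ = ((n - 1) / 2) • J := by
    rw [← hJT, ← transpose_mul, hAJ, transpose_smul]
  have hJJ : J * J = n • J := by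
    ext v w
    simp [mul_apply, hJ, hn]
  have hAT : Aᵀ = J - 1 - A := by rw [← hT.1.adjacencyMatrix_add_transpose]; abel
  rw [hx, hT.laplacian_eq, ← hA, ← hn]
  simp only [transpose_add, transpose_sub, transpose_smul, transpose_one, hJT, add_mul, sub_mul,
    mul_add, mul_sub, smul_mul_assoc, mul_smul_comm, one_mul, mul_one, hAJ, hJA, hJJ]
  generalize A * Aᵀ = G
  rw [hAT]
  module

end Digraph

/-! ### The bound and its equality case -/

theorem mainTheorem2 {V : Type*} [Fintype V] [DecidableEq V] (T : Digraph V)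
    (hT : T.IsEulerianTournament) :
    (∀ u v : V, T.arb u = T.arb v) ∧
    ∀ v : V,
      (T.arb v : ℝ) ≤ 1 / (Fintype.card V : ℝ) *
        ((Fintype.card V : ℝ) * ((Fintype.card V : ℝ) + 1) / 4) ^
          (((Fintype.card V : ℝ) - 1) / 2) ∧
      ((T.arb v : ℝ) = 1 / (Fintype.card V : ℝ) *
          ((Fintype.card V : ℝ) * ((Fintype.card V : ℝ) + 1) / 4) ^
            (((Fintype.card V : ℝ) - 1) / 2) ↔
        T.IsHadamardTournament) := by
  have hcard : ∀ _ : V, 0 < (Fintype.card V : ℝ) := fun v =>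
    Nat.cast_pos.mpr (Fintype.card_pos_iff.mpr ⟨v⟩)
  refine ⟨fun u v => ?_, fun v => ?_⟩
  · have h := (hT.det_laplacian_add_const 1 u).symm.trans (hT.det_laplacian_add_const 1 v)
    have hn := hcard u
    exact_mod_cast mul_left_cancel₀ (by positivity) h
  · have hn := hcard v
    have hgram := hT.laplacian_add_const_mul_transpose
    have hdet := fun x => hT.det_laplacian_add_const x v
    set n : ℝ := (Fintype.card V : ℝ) with hn_def
    set c : ℝ := n * (n + 1) / 4 with hc_def
    have hc : 0 < c := by positivity
    -- The all-ones vector is an eigenvector of the perturbed Laplacian with eigenvalue `n * x`;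
    -- this `x` makes it `√c`, the common value of all singular values in the extremal case.
    obtain ⟨x, hx⟩ : ∃ x, x = √c / n := ⟨_, rfl⟩
    have hnx : n * x = √c := by rw [hx]; field_simp
    have hnx2 : n * x ^ 2 = (n + 1) / 4 := by
      have h : n * (n * x ^ 2) = n * ((n + 1) / 4) := by
        rw [← mul_assoc, ← sq, ← mul_pow, hnx, Real.sq_sqrt hc.le, hc_def]; ring
      exact mul_left_cancel₀ hn.ne' h
    specialize hgram x
    specialize hdet x
    set M := T.laplacian + of fun _ _ => x with hM
    have hpsd : (M * Mᵀ).PosSemidef := by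
      simpa using posSemidef_self_mul_conjTranspose M
    have htr : (M * Mᵀ).trace = Fintype.card V * c := by
      have hA : (T.adjacencyMatrix * T.adjacencyMatrixᵀ).trace = n * ((n - 1) / 2) := by
        have h : ∀ u w, T.adjacencyMatrix u w * T.adjacencyMatrix u w = T.adjacencyMatrix u w :=
          fun u w => by simp [Digraph.adjacencyMatrix]
        simp [trace, mul_apply, h, Digraph.sum_adjacencyMatrix, hT.outDegree_eq, hn_def]
      have hJ : (of fun _ _ => (1 : ℝ) : Matrix V V ℝ).trace = n := by simp [trace, hn_def]
      rw [hgram, trace_add, trace_add, trace_smul, trace_smul, trace_one, hA, hJ, hnx2, hc_def,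
        ← hn_def, smul_eq_mul, smul_eq_mul]
      ring
    obtain ⟨hle, heq⟩ := hpsd.det_le_pow_card_of_trace_eq hc htr
    have hHad : M * Mᵀ = c • 1 ↔ T.IsHadamardTournament := by
      rw [Digraph.IsHadamardTournament, and_iff_right hT.1, hgram, hnx2, ← sub_eq_zero,
        ← sub_eq_zero (b := _ + _), ← hn_def]
      refine Eq.congr_left ?_
      rw [hc_def]
      module
    obtain ⟨B, hB⟩ : ∃ B, B = 1 / n * c ^ ((n - 1) / 2) := ⟨_, rfl⟩
    have hB0 : 0 < B := by rw [hB]; positivity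
    have hK : 0 < n * √c := mul_pos hn (Real.sqrt_pos.mpr hc)
    have hdetM : (M * Mᵀ).det = (n * √c * T.arb v) ^ 2 := by
      rw [det_mul, det_transpose, hdet, ← hnx]; ring
    have hBpow : c ^ Fintype.card V = (n * √c * B) ^ 2 := by
      have h : n * √c * B = c ^ (n / 2) := by
        rw [hB, Real.sqrt_eq_rpow, show n / 2 = 1 / 2 + (n - 1) / 2 by ring, Real.rpow_add hc]
        field_simp
      rw [h, ← Real.rpow_natCast, ← hn_def, ← Real.rpow_natCast, ← Real.rpow_mul hc.le]
      norm_num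
    rw [hdetM, hBpow] at hle heq
    have hnonneg : (0 : ℝ) ≤ n * √c * T.arb v := mul_nonneg hK.le (Nat.cast_nonneg _)
    have hnonneg' : 0 ≤ n * √c * B := (mul_pos hK hB0).le
    rw [← hB, ← hHad, ← heq, pow_left_inj₀ hnonneg hnonneg' two_ne_zero]
    exact ⟨le_of_mul_le_mul_left (abs_le_of_sq_le_sq' hle hnonneg').2 hK,
      (mul_right_inj' hK.ne').symm⟩
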